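/- Let $\xi=(\xi_1,\xi_2,\dots)$ be a sequence of integrable real random variables on a probability space $(\Omega,\mathcal F,\mathbf P)$ with $\xi_i>0$ a.s. for every $i$. Suppose that $\xi$ is swap-invariant, i.e. for every $d$, all indices $k_1<\dots<k_d$, every permutation $\sigma$ of $\{1,\dots,d\}$ and all $u\in\mathbb R^d$, $$\mathbf E\Bigl|\sum_{i=1}^d u_i\,\xi_{k_{\sigma(i)}}\Bigr|=\mathbf E\Bigl|\sum_{i=1}^d u_i\,\xi_{k_i}\Bigr|.$$ Let $\tilde\xi=(\xi_2/\xi_1,\xi_3/\xi_1,\dots)$, and let $\mathcal E_{\tilde\xi}$ be its permutation-invariant $\sigma$-algebra, i.e. the $\sigma$-algebra of all events $\{\tilde\xi\in B\}$ with $B\subset\mathbb R^{\mathbb N}$ a Borel set (for the product $\sigma$-algebra) that is invariant under all permutations of the coordinates moving only finitely many of them. Then $\mathbf E(\xi_1\mid\mathcal E_{\tilde\xi})>0$ a.s., the random variable $$X=\frac{\xi_1}{\mathbf E(\xi_1\mid\mathcal E_{\tilde\xi})}\,\mathbf E(\xi_2\mid\mathcal E_{\tilde\xi})$$ is integrable,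 and $$\frac1n\sum_{i=1}^n\xi_i\longrightarrow X\qquad\text{a.s. and in }L^1\text{ as }n\to\infty.$$ -/

import Mathlib

open MeasureTheory Filter Topology
open scoped ENNReal

namespace SwapInvariance

/-- Two random vectors `X` and `Y` in `ℝ^d` (given by their coordinates) are zonoid equivalent:
`E|⟨u, X⟩| = E|⟨u, Y⟩|` for all `u ∈ ℝ^d`. It is applied to integrable vectors only. -/
def ZonoidEquivalent {Ω Ω' : Type*} [MeasurableSpace Ω] [MeasurableSpace Ω'] {d : ℕ}
    (μ : Measure Ω) (ν : Measure Ω') (X : Fin d → Ω → ℝ) (Y : Fin d → Ω' → ℝ) : Prop :=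
  ∀ u : Fin d → ℝ, ∫ ω, |∑ i, u i * X i ω| ∂μ = ∫ ω, |∑ i, u i * Y i ω| ∂ν

/-- An integrable random vector is swap-invariant if every random vector obtained by permuting
its coordinates is zonoid equivalent to it. -/
def IsSwapInvariantVector {Ω : Type*} [MeasurableSpace Ω] {d : ℕ}
    (μ : Measure Ω) (X : Fin d → Ω → ℝ) : Prop :=
  (∀ i, Integrable (X i) μ) ∧
    ∀ σ : Equiv.Perm (Fin d), ZonoidEquivalent μ μ (fun i => X (σ i)) X

/-- A sequence of integrable random variables is swap-invariant if all its finite subsequences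
are swap-invariant. -/
def IsSwapInvariantSeq {Ω : Type*} [MeasurableSpace Ω]
    (μ : Measure Ω) (ξ : ℕ → Ω → ℝ) : Prop :=
  (∀ i, Integrable (ξ i) μ) ∧
    ∀ (d : ℕ) (k : Fin d → ℕ), StrictMono k → IsSwapInvariantVector μ (fun i => ξ (k i))

/-- The σ-algebra of those Borel sets of `ℝ^ℕ` that are invariant under every permutation of the
coordinates which moves only finitely many of them. -/
@[reducible] def permInvariantSets : MeasurableSpace (ℕ → ℝ) where
  MeasurableSet' s := MeasurableSet s ∧
    ∀ σ : Equiv.Perm ℕ, {n | σ n ≠ n}.Finite → (fun x : ℕ → ℝ => x ∘ σ) ⁻¹' s = s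
  measurableSet_empty := ⟨MeasurableSet.empty, fun _ _ => rfl⟩
  measurableSet_compl s hs :=
    ⟨hs.1.compl, fun σ hσ => by rw [Set.preimage_compl, hs.2 σ hσ]⟩
  measurableSet_iUnion f hf :=
    ⟨MeasurableSet.iUnion fun i => (hf i).1, fun σ hσ => by
      rw [Set.preimage_iUnion]; exact Set.iUnion_congr fun i => (hf i).2 σ hσ⟩

/-- The permutation-invariant σ-algebra `𝓔_ζ` of a random sequence `ζ`: the events `{ζ ∈ B}` with
`B` invariant under finite permutations. -/
@[reducible] def permInvariantSigma {Ω : Type*} (ζ : ℕ → Ω → ℝ) : MeasurableSpace Ω :=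
  permInvariantSets.comap (fun ω n => ζ n ω)

/-- `𝓔_ζ` is a sub-σ-algebra of the ambient one. -/
theorem permInvariantSigma_le {Ω : Type*} [m0 : MeasurableSpace Ω] {ζ : ℕ → Ω → ℝ}
    (hζ : ∀ n, Measurable (ζ n)) : permInvariantSigma ζ ≤ m0 := by
  rintro _ ⟨t, ht, rfl⟩
  exact (measurable_pi_lambda _ hζ) ht.1

/-- For `ξ = (ξ 0, ξ 1, ξ 2, …)`, the sequence of ratios `(ξ 1 / ξ 0, ξ 2 / ξ 0, …)`. -/
noncomputable def ratioSeq {Ω : Type*} (ξ : ℕ → Ω → ℝ) : ℕ → Ω → ℝ :=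
  fun n ω => ξ (n + 1) ω / ξ 0 ω

/-- The random variable `ξ 0 * E(ξ 1 | 𝓔) / E(ξ 0 | 𝓔)`, where `𝓔` is the permutation-invariant
σ-algebra of the sequence of ratios. -/
noncomputable def ergodicLimit {Ω : Type*} [MeasurableSpace Ω] (μ : Measure Ω)
    (ξ : ℕ → Ω → ℝ) : Ω → ℝ :=
  fun ω => ξ 0 ω / (μ[ξ 0 | permInvariantSigma (ratioSeq ξ)]) ω *
    (μ[ξ 1 | permInvariantSigma (ratioSeq ξ)]) ω

end SwapInvariance

/-! Change the measure: let Q have density `ξ 0` with respect to P, and let r_j = ξ_{j+1}/ξ_0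
(indices from 0). Since ξ_0 > 0, E|∑ v_j ξ_{j+1} - t ξ_0| = E_Q|∑ v_j r_j - t|. Swap-invariance
under transpositions fixing ξ_0 says that these quantities do not change when the r_j are swapped.
The right derivative in t of E_Q|Y - t| gives the distribution function of Y, so by Cramér–Wold they
determine the Q-law of r, which is thus exchangeable (`IsSwapInvariantSeq.map_swap_ratioLaw`). Under
an exchangeable law the mean of the first n coordinates is the conditional expectation of the first
coordinate given the n-symmetric sets. These σ-algebras decrease to the permutation-invariant one,
so reverse martingale convergence gives the limit g a.s. and in L¹. Back under P, the mean of n + 1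
terms of ξ is ξ_0 (1 + r_0 + ... + r_{n-1})/(n + 1). Q and P have the same null sets, and
L¹(Q)-norms are L¹(P)-norms weighted by ξ_0, so the means tend to ξ_0 g(r). Bayes' formula
(`condExp_one_ae_eq`) identifies g(r) as E(ξ_1 | 𝓔)/E(ξ_0 | 𝓔). -/

open MeasureTheory Filter Topology
open scoped ENNReal

namespace SwapInvariance

/-! ### Reverse martingale convergence -/

section ReverseMartingale

variable {Ω : Type*} {m0 : MeasurableSpace Ω} {μ : Measure Ω} {G : ℕ → MeasurableSpace Ω}

/-- Doob's maximal inequality for the reverse martingale of the conditional expectations given a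
decreasing sequence of σ-algebras. -/
theorem mul_measure_exists_le_abs_condExp_le [IsFiniteMeasure μ] (hG : Antitone G)
    (hle : ∀ n, G n ≤ m0) {f : Ω → ℝ} (ε : NNReal) :
    ε * μ {ω | ∃ n, (ε : ℝ) ≤ |(μ[f | G n]) ω|} ≤ eLpNorm f 1 μ := by
  have key : ∀ N : ℕ, ε * μ {ω | ∃ n ≤ N, (ε : ℝ) ≤ |(μ[f | G n]) ω|} ≤ eLpNorm f 1 μ := by
    intro N
    -- Reversing time on 0, ..., N gives an ordinary martingale with last term `μ[f | G 0]`, to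
    -- which the forward maximal inequality applies.
    let F : Filtration ℕ m0 :=
      { seq := fun k => G (N - k)
        mono' := fun i j hij => hG (by omega)
        le' := fun k => hle _ }
    have hM : Martingale (fun k => μ[f | F k]) F μ := martingale_condExp f F μ
    have hsub : Submartingale (fun k ω => |(μ[f | F k]) ω|) F μ :=
      hM.submartingale.sup hM.neg.submartingale
    refine le_trans ?_ ((maximal_ineq hsub (fun k ω => abs_nonneg _) (ε := ε) N).trans ?_)
    · refine mul_le_mul_right (measure_mono ?_) _
      rintro ω ⟨n, hn, hω⟩
      simp only [Set.mem_ofPred_eq, Finset.le_sup'_iff, Finset.mem_range]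
      refine ⟨N - n, by omega, ?_⟩
      have : F (N - n) = G n := by
        change G (N - (N - n)) = G n
        congr 1; omega
      rw [this]; exact hω
    · refine le_trans ?_ (eLpNorm_condExp_le_eLpNorm (m := F N) (μ := μ) f le_rfl)
      rw [eLpNorm_one_eq_lintegral_enorm]
      refine (ENNReal.ofReal_le_ofReal (setIntegral_le_integral (hsub.integrable N)
        (ae_of_all _ fun ω => abs_nonneg _))).trans ?_
      rw [ofReal_integral_eq_lintegral_ofReal (hsub.integrable N)
        (ae_of_all _ fun ω => abs_nonneg _)]
      simp [Real.enorm_eq_ofReal_abs]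
  have hset : {ω | ∃ n, (ε : ℝ) ≤ |(μ[f | G n]) ω|} =
      ⋃ N : ℕ, {ω | ∃ n ≤ N, (ε : ℝ) ≤ |(μ[f | G n]) ω|} := by
    ext ω
    simp only [Set.mem_ofPred_eq, Set.mem_iUnion]
    exact ⟨fun ⟨n, hn⟩ => ⟨n, n, le_rfl, hn⟩, fun ⟨_, n, _, hn⟩ => ⟨n, hn⟩⟩
  have hmono : Monotone fun N : ℕ => {ω | ∃ n ≤ N, (ε : ℝ) ≤ |(μ[f | G n]) ω|} :=
    fun i j hij ω ⟨n, hn, hω⟩ => ⟨n, hn.trans hij, hω⟩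
  rw [hset, hmono.measure_iUnion, ENNReal.mul_iSup]
  exact iSup_le key

/-- A function which is a.e. measurable with respect to each σ-algebra of a decreasing sequence is
a.e. measurable with respect to their intersection. -/
theorem aestronglyMeasurable_iInf_of_antitone (hG : Antitone G) {f : Ω → ℝ}
    (hf : ∀ n, AEStronglyMeasurable[G n] f μ) : AEStronglyMeasurable[⨅ n, G n] f μ := by
  choose g hg hfg using hf
  -- A limsup ignores finitely many terms, so it is `G m`-measurable for every m; almost everywhere
  -- it is the limsup of a constant sequence.
  refine ⟨fun ω => limsup (fun n => g n ω) atTop, ?_, ?_⟩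
  · refine Measurable.stronglyMeasurable ?_
    intro s hs
    rw [MeasurableSpace.measurableSet_iInf]
    intro m
    have : (fun ω => limsup (fun n => g n ω) atTop) =
        fun ω => limsup (fun n => g (n + m) ω) atTop := by
      ext ω; exact (limsup_nat_add (fun n => g n ω) m).symm
    rw [this]
    exact Measurable.limsup (mδ := G m)
      (fun n => ((hg (n + m)).measurable.mono (hG (by omega)) le_rfl)) hs
  · filter_upwards [ae_all_iff.2 hfg] with ω hω
    simp [← hω]

/-- `L²` version of the reverse martingale convergence theorem. -/
theorem tendsto_eLpNorm_two_condExp_iInf [IsFiniteMeasure μ] (hG : Antitone G)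
    (hle : ∀ n, G n ≤ m0) {f : Ω → ℝ} (hf : MemLp f 2 μ) :
    Tendsto (fun n => eLpNorm (μ[f | G n] - μ[f | ⨅ n, G n]) 2 μ) atTop (𝓝 0) := by
  have hfact : ∀ n, Fact (G n ≤ m0) := fun n => ⟨hle n⟩
  have hle' : ⨅ n, G n ≤ m0 := (iInf_le _ 0).trans (hle 0)
  have hfact' : Fact (⨅ n, G n ≤ m0) := ⟨hle'⟩
  let U : ℕ → Submodule ℝ (Lp ℝ 2 μ) := fun n => lpMeas ℝ ℝ (G n) 2 μ
  let V : Submodule ℝ (Lp ℝ 2 μ) := lpMeas ℝ ℝ (⨅ n, G n) 2 μ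
  have hU : ⨅ n, U n = V := by
    ext x
    simp only [U, V, Submodule.mem_iInf, mem_lpMeas_iff_aestronglyMeasurable]
    exact ⟨aestronglyMeasurable_iInf_of_antitone hG, fun h n => h.mono (iInf_le _ n)⟩
  -- Conditional expectations are projections onto decreasing closed subspaces; their complements
  -- increase, so convergence of projections for increasing subspaces applies.
  have hanti : Monotone fun n => (U n)ᗮ := fun i j hij => Submodule.orthogonal_le fun x hx => by
    simp only [U, mem_lpMeas_iff_aestronglyMeasurable] at hx ⊢
    exact hx.mono (hG hij)
  have hV : (⨆ n, (U n)ᗮ).topologicalClosure = Vᗮ := by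
    rw [← Submodule.orthogonal_orthogonal_eq_closure, ← hU, ← Submodule.iInf_orthogonal]
    simp [Submodule.orthogonal_orthogonal, U]
  have ht := Submodule.starProjection_tendsto_closure_iSup (fun n => (U n)ᗮ) hanti (hf.toLp f)
  simp only [hV, Submodule.starProjection_orthogonal_val] at ht
  have ht' : Tendsto (fun n => (U n).starProjection (hf.toLp f)) atTop
      (𝓝 (V.starProjection (hf.toLp f))) := by
    simpa using (tendsto_const_nhds (x := hf.toLp f)).sub ht
  have hUn : ∀ n, ((U n).starProjection (hf.toLp f) : Ω → ℝ) =ᵐ[μ] μ[f | G n] := fun n =>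
    hf.condExpL2_ae_eq_condExp (𝕜 := ℝ) (hle n)
  have hVn : (V.starProjection (hf.toLp f) : Ω → ℝ) =ᵐ[μ] μ[f | ⨅ n, G n] :=
    hf.condExpL2_ae_eq_condExp (𝕜 := ℝ) hle'
  rw [Lp.tendsto_Lp_iff_tendsto_eLpNorm'] at ht'
  refine ht'.congr fun n => eLpNorm_congr_ae ?_
  exact (hUn n).sub hVn

/-- `L¹` version of the reverse martingale convergence theorem. -/
theorem tendsto_eLpNorm_one_condExp_iInf [IsFiniteMeasure μ] (hG : Antitone G)
    (hle : ∀ n, G n ≤ m0) {f : Ω → ℝ} (hf : Integrable f μ) :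
    Tendsto (fun n => eLpNorm (μ[f | G n] - μ[f | ⨅ n, G n]) 1 μ) atTop (𝓝 0) := by
  rw [ENNReal.tendsto_nhds_zero]
  intro ε hε
  have hε3 : ε / 3 ≠ 0 := by simp [hε.ne']
  -- Approximating by a simple function reduces to L²; conditional expectations contract L¹, so each
  -- replacement costs at most ε/3.
  obtain ⟨g, hfg, -⟩ := (memLp_one_iff_integrable.2 hf).exists_simpleFunc_eLpNorm_sub_lt
    ENNReal.one_ne_top hε3
  have hg2 : MemLp g 2 μ := g.memLp_of_isFiniteMeasure 2 μ
  have hg1 : Integrable g μ := g.integrable_of_isFiniteMeasure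
  have h2 := tendsto_eLpNorm_two_condExp_iInf hG hle hg2
  have h1 : Tendsto (fun n => eLpNorm (μ[g | G n] - μ[g | ⨅ n, G n]) 1 μ) atTop (𝓝 0) := by
    have hc : Tendsto (fun n => eLpNorm (μ[g | G n] - μ[g | ⨅ n, G n]) 2 μ *
        μ Set.univ ^ (1 / (1 : ℝ≥0∞).toReal - 1 / (2 : ℝ≥0∞).toReal)) atTop (𝓝 0) := by
      have := ENNReal.Tendsto.mul_const h2 (b := μ Set.univ ^
        (1 / (1 : ℝ≥0∞).toReal - 1 / (2 : ℝ≥0∞).toReal)) (Or.inr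
          (ENNReal.rpow_ne_top_of_nonneg (by norm_num) (measure_ne_top _ _)))
      simpa using this
    refine tendsto_of_tendsto_of_tendsto_of_le_of_le tendsto_const_nhds hc (fun _ => zero_le)
      fun n => eLpNorm_le_eLpNorm_mul_rpow_measure_univ one_le_two ?_
    exact (integrable_condExp.sub integrable_condExp).aestronglyMeasurable
  filter_upwards [ENNReal.tendsto_nhds_zero.1 h1 (ε / 3) (pos_iff_ne_zero.2 hε3)] with n hn
  have hcontr : ∀ m : MeasurableSpace Ω, eLpNorm (μ[f | m] - μ[g | m]) 1 μ ≤ ε / 3 := fun m => by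
    rw [← eLpNorm_congr_ae (condExp_sub hf hg1 m)]
    exact (eLpNorm_condExp_le_eLpNorm _ le_rfl).trans hfg.le
  have hsplit : μ[f | G n] - μ[f | ⨅ n, G n] =
      (μ[f | G n] - μ[g | G n]) + ((μ[g | G n] - μ[g | ⨅ n, G n]) +
        (μ[g | ⨅ n, G n] - μ[f | ⨅ n, G n])) := by abel
  have hm : ∀ (u v : Ω → ℝ) (m m' : MeasurableSpace Ω),
      AEStronglyMeasurable[m0] (μ[u | m] - μ[v | m']) μ := fun u v m m' =>
    (integrable_condExp.sub integrable_condExp).aestronglyMeasurable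
  rw [hsplit]
  refine (eLpNorm_add_le (hm _ _ _ _) ((hm _ _ _ _).add (hm _ _ _ _)) le_rfl).trans ?_
  refine (add_le_add (hcontr _) (eLpNorm_add_le (hm _ _ _ _) (hm _ _ _ _) le_rfl)).trans ?_
  refine (add_le_add le_rfl (add_le_add hn (d := ε / 3) ?_)).trans ?_
  · rw [eLpNorm_sub_comm]; exact hcontr _
  · rw [← add_assoc, ENNReal.add_thirds]

/-- Reverse martingale convergence theorem (Lévy's downward theorem). -/
theorem tendsto_ae_condExp_iInf [IsFiniteMeasure μ] (hG : Antitone G)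
    (hle : ∀ n, G n ≤ m0) {f : Ω → ℝ} (hf : Integrable f μ) :
    ∀ᵐ ω ∂μ, Tendsto (fun n => (μ[f | G n]) ω) atTop (𝓝 ((μ[f | ⨅ n, G n]) ω)) := by
  have hle' : ⨅ n, G n ≤ m0 := (iInf_le _ 0).trans (hle 0)
  set g := μ[f | ⨅ n, G n] with hgdef
  have hgi : Integrable g μ := integrable_condExp
  -- From time m on, the deviation from the limit is the reverse martingale generated by `μ[f | G m]
  -- - g`. The maximal inequality bounds its oscillation by an L¹ norm that tends to 0.
  have hcond : ∀ᵐ ω ∂μ, ∀ m n, m ≤ n →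
      (μ[μ[f | G m] - g | G n]) ω = (μ[f | G n]) ω - g ω := by
    rw [ae_all_iff]; intro m
    rw [ae_all_iff]; intro n
    by_cases hmn : m ≤ n
    swap
    · exact ae_of_all _ fun ω h => absurd h hmn
    have hgn : μ[g | G n] = g := condExp_of_stronglyMeasurable (hle n)
      (stronglyMeasurable_condExp.mono (iInf_le _ n)) hgi
    filter_upwards [condExp_sub (m := G n) (integrable_condExp (f := f) (m := G m) (μ := μ)) hgi,
      condExp_condExp_of_le (f := f) (μ := μ) (hG hmn) (hle m)] with ω h1 h2 _
    rw [h1, Pi.sub_apply, h2, hgn]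
  have hbad : ∀ k : ℕ, ∀ᵐ ω ∂μ, ∃ m, ∀ n ≥ m, |(μ[f | G n]) ω - g ω| < ((k : ℝ) + 1)⁻¹ := by
    intro k
    set ε : NNReal := ((k : NNReal) + 1)⁻¹ with hε
    have hεr : (ε : ℝ) = ((k : ℝ) + 1)⁻¹ := by simp [hε]
    have hε0 : (ε : ℝ≥0∞) ≠ 0 := by
      simp [hε]
    have hzero : μ {ω | ∀ m, ∃ n ≥ m, (ε : ℝ) ≤ |(μ[f | G n]) ω - g ω|} = 0 := by
      have hb : ∀ m, ε * μ {ω | ∀ m, ∃ n ≥ m, (ε : ℝ) ≤ |(μ[f | G n]) ω - g ω|} ≤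
          eLpNorm (μ[f | G m] - g) 1 μ := fun m => by
        refine le_trans ?_ (mul_measure_exists_le_abs_condExp_le hG hle ε)
        refine mul_le_mul_right (measure_mono_ae ?_) _
        filter_upwards [hcond] with ω hω h
        obtain ⟨n, hn, hn'⟩ := h m
        exact ⟨n, by rw [hω m n hn]; exact hn'⟩
      have := ge_of_tendsto' (tendsto_eLpNorm_one_condExp_iInf hG hle hf) hb
      exact (mul_eq_zero.1 (le_antisymm this zero_le)).resolve_left hε0
    rw [← hεr]
    filter_upwards [measure_eq_zero_iff_ae_notMem.1 hzero] with ω hω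
    simpa using hω
  filter_upwards [ae_all_iff.2 hbad] with ω hω
  rw [Metric.tendsto_atTop]
  intro δ hδ
  obtain ⟨k, hk⟩ := exists_nat_one_div_lt hδ
  obtain ⟨m, hm⟩ := hω k
  refine ⟨m, fun n hn => (hm n hn).trans ?_⟩
  simpa using hk

end ReverseMartingale
end SwapInvariance

namespace SwapInvariance

/-! ### Laws determined by absolute moments -/

section AbsoluteMoments

/-- The right derivative of s ↦ |y - s| at t is 1 if y ≤ t and -1 otherwise; difference quotients
are bounded by 1, so dominated convergence applies. -/
theorem tendsto_integral_abs_sub_slope (μ : Measure ℝ) [IsFiniteMeasure μ] (hμ : Integrable id μ)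
    (t : ℝ) :
    Tendsto (fun n : ℕ => ((n : ℝ) + 1) *
        (∫ y, |y - (t + ((n : ℝ) + 1)⁻¹)| ∂μ - ∫ y, |y - t| ∂μ)) atTop
      (𝓝 (2 * μ.real (Set.Iic t) - μ.real Set.univ)) := by
  have hint : ∀ s : ℝ, Integrable (fun y : ℝ => |y - s|) μ := fun s =>
    (hμ.sub (integrable_const s)).abs
  have hlim : ∫ y, (2 * (Set.Iic t).indicator (fun _ => (1 : ℝ)) y - 1) ∂μ =
      2 * μ.real (Set.Iic t) - μ.real Set.univ := by
    rw [integral_sub (((integrable_const _).indicator measurableSet_Iic).const_mul _)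
      (integrable_const _), integral_const_mul, integral_indicator_const _ measurableSet_Iic]
    simp
  rw [← hlim]
  have heq : ∀ n : ℕ, ((n : ℝ) + 1) *
      (∫ y, |y - (t + ((n : ℝ) + 1)⁻¹)| ∂μ - ∫ y, |y - t| ∂μ) =
      ∫ y, ((n : ℝ) + 1) * (|y - (t + ((n : ℝ) + 1)⁻¹)| - |y - t|) ∂μ := fun n => by
    rw [integral_const_mul, integral_sub (hint _) (hint _)]
  simp_rw [heq]
  refine tendsto_integral_of_dominated_convergence (fun _ => (1 : ℝ))
    (fun n => (((hint _).sub (hint _)).const_mul _).aestronglyMeasurable) (integrable_const _)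
    (fun n => ae_of_all _ fun y => ?_) (ae_of_all _ fun y => ?_)
  · have hn : (0 : ℝ) < (n : ℝ) + 1 := by positivity
    rw [Real.norm_eq_abs, abs_mul, abs_of_pos hn]
    have h := abs_abs_sub_abs_le_abs_sub (y - (t + ((n : ℝ) + 1)⁻¹)) (y - t)
    have h2 : |y - (t + ((n : ℝ) + 1)⁻¹) - (y - t)| = ((n : ℝ) + 1)⁻¹ := by
      rw [show y - (t + ((n : ℝ) + 1)⁻¹) - (y - t) = -((n : ℝ) + 1)⁻¹ by ring, abs_neg,
        abs_of_pos (by positivity)]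
    rw [h2] at h
    calc _ ≤ ((n : ℝ) + 1) * ((n : ℝ) + 1)⁻¹ := by gcongr
      _ = 1 := mul_inv_cancel₀ hn.ne'
  · refine tendsto_const_nhds.congr' ?_
    by_cases hy : y ≤ t
    · refine Eventually.of_forall fun n => ?_
      have hn : (0 : ℝ) < ((n : ℝ) + 1)⁻¹ := by positivity
      dsimp only
      rw [Set.indicator_of_mem (by exact hy),
        abs_of_nonpos (by linarith : y - (t + ((n : ℝ) + 1)⁻¹) ≤ 0),
        abs_of_nonpos (by linarith : y - t ≤ 0)]
      field_simp
      ring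
    · rw [not_le] at hy
      obtain ⟨k, hk⟩ := exists_nat_one_div_lt (sub_pos.2 hy)
      filter_upwards [eventually_ge_atTop k] with n hn
      have hnk : ((n : ℝ) + 1)⁻¹ ≤ 1 / ((k : ℝ) + 1) := by
        rw [← one_div]
        exact one_div_le_one_div_of_le (by positivity) (by gcongr)
      rw [Set.indicator_of_notMem (by simpa using hy), abs_of_nonneg (by linarith),
        abs_of_nonneg (by linarith)]
      field_simp
      ring

/-- An integrable law on the line is determined by its absolute moments about all points. -/
theorem ext_of_integral_abs_sub {μ ν : Measure ℝ} [IsFiniteMeasure μ] [IsFiniteMeasure ν]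
    (hμ : Integrable id μ) (hν : Integrable id ν) (huniv : μ Set.univ = ν Set.univ)
    (h : ∀ t : ℝ, ∫ y, |y - t| ∂μ = ∫ y, |y - t| ∂ν) : μ = ν := by
  refine Measure.ext_of_Iic _ _ fun t => ?_
  have h1 := tendsto_integral_abs_sub_slope μ hμ t
  simp_rw [h] at h1
  have h2 := tendsto_nhds_unique h1 (tendsto_integral_abs_sub_slope ν hν t)
  have h3 : μ.real Set.univ = ν.real Set.univ := by simp [Measure.real, huniv]
  rw [← ENNReal.toReal_eq_toReal_iff' (measure_ne_top _ _) (measure_ne_top _ _)]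
  change μ.real _ = ν.real _
  linarith

/-- A law on `ℝ^ℕ` with integrable coordinates is determined by the absolute moments about all
points of the finite linear combinations of the coordinates. -/
theorem ext_of_integral_abs_sum_sub {π ρ : Measure (ℕ → ℝ)} [IsFiniteMeasure π]
    [IsFiniteMeasure ρ] (hπ : ∀ i, Integrable (fun x => x i) π)
    (hρ : ∀ i, Integrable (fun x => x i) ρ) (huniv : π Set.univ = ρ Set.univ)
    (h : ∀ (N : ℕ) (v : ℕ → ℝ) (t : ℝ), ∫ x, |∑ i ∈ Finset.range N, v i * x i - t| ∂π =
      ∫ x, |∑ i ∈ Finset.range N, v i * x i - t| ∂ρ) : π = ρ := by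
  refine IsProjectiveLimit.unique (P := fun I : Finset ℕ => ρ.map I.restrict) (fun I => ?_)
    (fun I => rfl)
  refine Measure.ext_of_charFunDual (funext fun L => ?_)
  have hr : Measurable (I.restrict : (ℕ → ℝ) → (I → ℝ)) := Finset.measurable_restrict I
  rw [charFunDual_eq_charFun_map_one, charFunDual_eq_charFun_map_one,
    Measure.map_map (by fun_prop) hr, Measure.map_map (by fun_prop) hr]
  -- Cramér–Wold: `v` holds the coefficients of the functional `L`, extended by zero outside `I`.
  let v : ℕ → ℝ := fun i => if hi : i ∈ I then L (Pi.single ⟨i, hi⟩ 1) else 0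
  obtain ⟨N, hN⟩ : ∃ N, I ⊆ Finset.range N := I.exists_nat_subset_range
  have hL : (⇑L ∘ I.restrict : (ℕ → ℝ) → ℝ) = fun x => ∑ i ∈ Finset.range N, v i * x i := by
    ext x
    rw [← Finset.sum_subset hN (fun i _ hi => by simp [v, hi]), ← Finset.sum_coe_sort]
    conv_lhs => rw [Function.comp_apply, pi_eq_sum_univ' (I.restrict x), map_sum]
    refine Finset.sum_congr rfl fun i _ => ?_
    simp only [map_smul, smul_eq_mul, Finset.restrict, v, Finset.coe_mem, dite_true]
    rw [mul_comm]
  rw [hL]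
  have hm : Measurable fun x : ℕ → ℝ => ∑ i ∈ Finset.range N, v i * x i := by fun_prop
  congr 1
  refine ext_of_integral_abs_sub ?_ ?_ ?_ fun t => ?_
  · rw [integrable_map_measure (by fun_prop) hm.aemeasurable, Function.id_comp]
    exact integrable_finsetSum (Finset.range N) fun i _ => (hπ i).const_mul _
  · rw [integrable_map_measure (by fun_prop) hm.aemeasurable, Function.id_comp]
    exact integrable_finsetSum (Finset.range N) fun i _ => (hρ i).const_mul _
  · rw [Measure.map_apply hm MeasurableSet.univ, Measure.map_apply hm MeasurableSet.univ]
    exact huniv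
  · rw [integral_map hm.aemeasurable (by fun_prop), integral_map hm.aemeasurable (by fun_prop)]
    exact h N v t

end AbsoluteMoments
end SwapInvariance

namespace SwapInvariance

/-! ### Ergodic theorem for exchangeable laws -/

section Exchangeable

/-- The σ-algebra of the Borel sets of `ℝ^ℕ` that are invariant under all permutations of the
first `n` coordinates. -/
@[reducible] def permInvariantSetsUpTo (n : ℕ) : MeasurableSpace (ℕ → ℝ) where
  MeasurableSet' s := MeasurableSet s ∧
    ∀ σ : Equiv.Perm ℕ, (∀ k, n ≤ k → σ k = k) → (fun x : ℕ → ℝ => x ∘ σ) ⁻¹' s = s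
  measurableSet_empty := ⟨MeasurableSet.empty, fun _ _ => rfl⟩
  measurableSet_compl s hs :=
    ⟨hs.1.compl, fun σ hσ => by rw [Set.preimage_compl, hs.2 σ hσ]⟩
  measurableSet_iUnion f hf :=
    ⟨MeasurableSet.iUnion fun i => (hf i).1, fun σ hσ => by
      rw [Set.preimage_iUnion]; exact Set.iUnion_congr fun i => (hf i).2 σ hσ⟩

theorem permInvariantSetsUpTo_le (n : ℕ) :
    permInvariantSetsUpTo n ≤ (inferInstance : MeasurableSpace (ℕ → ℝ)) :=
  fun _ hs => hs.1

theorem permInvariantSets_le :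
    permInvariantSets ≤ (inferInstance : MeasurableSpace (ℕ → ℝ)) :=
  fun _ hs => hs.1

theorem antitone_permInvariantSetsUpTo : Antitone permInvariantSetsUpTo :=
  fun _ _ hmn _ hs => ⟨hs.1, fun σ hσ => hs.2 σ fun k hk => hσ k (hmn.trans hk)⟩

theorem iInf_permInvariantSetsUpTo : ⨅ n, permInvariantSetsUpTo n = permInvariantSets := by
  refine MeasurableSpace.ext fun s => ?_
  rw [MeasurableSpace.measurableSet_iInf]
  refine ⟨fun h => ⟨(h 0).1, fun σ hσ => ?_⟩, fun h n => ⟨h.1, fun σ hσ => h.2 σ ?_⟩⟩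
  · obtain ⟨N, hN⟩ := hσ.bddAbove
    refine (h (N + 1)).2 σ fun k hk => ?_
    by_contra hk'
    have : k ≤ N := hN hk'
    omega
  · refine (Set.finite_lt_nat n).subset fun k hk => ?_
    by_contra hk'
    exact hk (hσ k (not_lt.1 hk'))

theorem measurable_sum_range_permInvariantSetsUpTo (n : ℕ) :
    Measurable[permInvariantSetsUpTo n] fun x : ℕ → ℝ => ∑ i ∈ Finset.range n, x i := by
  intro s hs
  refine ⟨(by fun_prop : Measurable fun x : ℕ → ℝ => ∑ i ∈ Finset.range n, x i) hs,
    fun σ hσ => ?_⟩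
  ext x
  simp only [Set.mem_preimage, Function.comp_apply]
  have : ∑ i ∈ Finset.range n, x (σ i) = ∑ i ∈ Finset.range n, x i := by
    refine Finset.sum_equiv σ (fun i => ?_) fun i _ => rfl
    simp only [Finset.mem_range]
    refine ⟨fun hi => ?_, fun hi => ?_⟩
    · by_contra hc
      have := σ.injective (hσ _ (not_lt.1 hc))
      omega
    · by_contra hc
      rw [hσ _ (not_lt.1 hc)] at hi
      exact hc hi
  rw [this]

variable {π : Measure (ℕ → ℝ)}

theorem integrable_eval_of_map_swap (hint : Integrable (fun x => x 0) π)
    (hex : ∀ i, π.map (fun x => x ∘ Equiv.swap 0 i) = π) (i : ℕ) :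
    Integrable (fun x => x i) π := by
  have hm : Measurable fun x : ℕ → ℝ => x ∘ Equiv.swap 0 i :=
    measurable_pi_lambda _ fun j => measurable_pi_apply _
  rw [← hex i, integrable_map_measure (measurable_pi_apply 0).aestronglyMeasurable
    hm.aemeasurable] at hint
  simpa [Function.comp_def] using hint

variable [IsFiniteMeasure π]

/-- For an exchangeable law, the empirical mean of the first `n` coordinates is the conditional
expectation of the first coordinate given the sets invariant under permutations of these. -/
theorem mean_ae_eq_condExp (hint : Integrable (fun x => x 0) π)
    (hex : ∀ i, π.map (fun x => x ∘ Equiv.swap 0 i) = π) {n : ℕ} (hn : n ≠ 0) :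
    (fun x => (n : ℝ)⁻¹ * ∑ i ∈ Finset.range n, x i) =ᵐ[π]
      π[fun x => x 0 | permInvariantSetsUpTo n] := by
  have hi := integrable_eval_of_map_swap hint hex
  refine ae_eq_condExp_of_forall_setIntegral_eq (permInvariantSetsUpTo_le n) hint
    (fun s _ _ => ?_) (fun s hs _ => ?_) ?_
  · exact ((integrable_finsetSum _ fun i _ => hi i).const_mul _).integrableOn
  · rw [integral_const_mul, integral_finsetSum _ fun i _ => (hi i).integrableOn]
    -- For i < n the transposition of 0 and i preserves both the law and `s`, so all n integrals
    -- agree. Only transpositions involving 0 are needed.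
    have : ∀ i ∈ Finset.range n, ∫ x in s, x i ∂π = ∫ x in s, x 0 ∂π := fun i hin => by
      have hm : Measurable fun x : ℕ → ℝ => x ∘ Equiv.swap 0 i :=
        measurable_pi_lambda _ fun j => measurable_pi_apply _
      conv_rhs => rw [← hex i]
      rw [setIntegral_map hs.1 (measurable_pi_apply 0).aestronglyMeasurable hm.aemeasurable, hs.2]
      · simp
      · intro k hk
        rw [Finset.mem_range] at hin
        exact Equiv.swap_apply_of_ne_of_ne (by omega) (by omega)
    rw [Finset.sum_congr rfl this]
    have : (n : ℝ) ≠ 0 := by exact_mod_cast hn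
    simp [this]
  · exact ((measurable_sum_range_permInvariantSetsUpTo n).const_mul _).aestronglyMeasurable

/-- Ergodic theorem for exchangeable sequences: almost sure convergence. -/
theorem tendsto_ae_mean_of_exchangeable (hint : Integrable (fun x => x 0) π)
    (hex : ∀ i, π.map (fun x => x ∘ Equiv.swap 0 i) = π) :
    ∀ᵐ x ∂π, Tendsto (fun n : ℕ => (n : ℝ)⁻¹ * ∑ i ∈ Finset.range n, x i) atTop
      (𝓝 ((π[fun x => x 0 | permInvariantSets]) x)) := by
  have h := tendsto_ae_condExp_iInf antitone_permInvariantSetsUpTo permInvariantSetsUpTo_le hint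
  rw [iInf_permInvariantSetsUpTo] at h
  have h2 : ∀ᵐ x ∂π, ∀ n : ℕ, n ≠ 0 → (n : ℝ)⁻¹ * ∑ i ∈ Finset.range n, x i =
      (π[fun x => x 0 | permInvariantSetsUpTo n]) x := by
    rw [ae_all_iff]
    intro n
    by_cases hn : n = 0
    · exact ae_of_all _ fun x h => absurd hn h
    · filter_upwards [mean_ae_eq_condExp hint hex hn] with x hx _ using hx
  filter_upwards [h, h2] with x hx hx2
  refine hx.congr' ?_
  filter_upwards [eventually_ne_atTop 0] with n hn using (hx2 n hn).symm

/-- Ergodic theorem for exchangeable sequences: convergence in `L¹`. -/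
theorem tendsto_eLpNorm_mean_of_exchangeable (hint : Integrable (fun x => x 0) π)
    (hex : ∀ i, π.map (fun x => x ∘ Equiv.swap 0 i) = π) :
    Tendsto (fun n : ℕ => eLpNorm (fun x => (n : ℝ)⁻¹ * (∑ i ∈ Finset.range n, x i) -
      (π[fun x => x 0 | permInvariantSets]) x) 1 π) atTop (𝓝 0) := by
  have h := tendsto_eLpNorm_one_condExp_iInf antitone_permInvariantSetsUpTo
    permInvariantSetsUpTo_le hint
  rw [iInf_permInvariantSetsUpTo] at h
  refine h.congr' ?_
  filter_upwards [eventually_ne_atTop 0] with n hn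
  exact eLpNorm_congr_ae ((mean_ae_eq_condExp hint hex hn).symm.sub (ae_eq_refl _))

/-- Adding a summand `1` to the first `n` coordinates does not affect the limit of the means. -/
theorem tendsto_ae_shifted_mean_of_exchangeable (hint : Integrable (fun x => x 0) π)
    (hex : ∀ i, π.map (fun x => x ∘ Equiv.swap 0 i) = π) :
    ∀ᵐ x ∂π, Tendsto (fun n : ℕ => ((n : ℝ) + 1)⁻¹ * (1 + ∑ i ∈ Finset.range n, x i)) atTop
      (𝓝 ((π[fun x => x 0 | permInvariantSets]) x)) := by
  filter_upwards [tendsto_ae_mean_of_exchangeable hint hex] with x hx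
  have h1 : Tendsto (fun n : ℕ => ((n : ℝ) + 1)⁻¹) atTop (𝓝 0) := by
    simpa [one_div] using tendsto_one_div_add_atTop_nhds_zero_nat (𝕜 := ℝ)
  have h2 := h1.add (((tendsto_const_nhds (x := (1 : ℝ))).sub h1).mul hx)
  rw [sub_zero, one_mul, zero_add] at h2
  refine h2.congr' ?_
  filter_upwards [eventually_ne_atTop 0] with n hn
  have : (n : ℝ) ≠ 0 := by exact_mod_cast hn
  field_simp
  ring

theorem tendsto_eLpNorm_shifted_mean_of_exchangeable (hint : Integrable (fun x => x 0) π)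
    (hex : ∀ i, π.map (fun x => x ∘ Equiv.swap 0 i) = π) :
    Tendsto (fun n : ℕ => eLpNorm (fun x => ((n : ℝ) + 1)⁻¹ * (1 + ∑ i ∈ Finset.range n, x i) -
      (π[fun x => x 0 | permInvariantSets]) x) 1 π) atTop (𝓝 0) := by
  set g := π[fun x => x 0 | permInvariantSets]
  have hg : Integrable g π := integrable_condExp
  have hi := integrable_eval_of_map_swap hint hex
  have h1 : Tendsto (fun n : ℕ => ((n : ℝ) + 1)⁻¹) atTop (𝓝 0) := by
    simpa [one_div] using tendsto_one_div_add_atTop_nhds_zero_nat (𝕜 := ℝ)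
  have hconst : Tendsto (fun n : ℕ => ENNReal.ofReal (((n : ℝ) + 1)⁻¹) *
      eLpNorm (fun x => 1 - g x) 1 π) atTop (𝓝 0) := by
    have := ENNReal.Tendsto.mul_const (ENNReal.tendsto_ofReal h1)
      (b := eLpNorm (fun x => 1 - g x) 1 π)
      (Or.inr (memLp_one_iff_integrable.2 ((integrable_const 1).sub hg)).eLpNorm_ne_top)
    simpa using this
  have hsum := hconst.add (tendsto_eLpNorm_mean_of_exchangeable hint hex)
  rw [add_zero] at hsum
  refine tendsto_of_tendsto_of_tendsto_of_le_of_le' tendsto_const_nhds hsum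
    (Eventually.of_forall fun _ => zero_le) ?_
  filter_upwards [eventually_ne_atTop 0] with n hn
  have hn0 : (n : ℝ) ≠ 0 := by exact_mod_cast hn
  have hmean : Integrable (fun x : ℕ → ℝ => (n : ℝ)⁻¹ * (∑ i ∈ Finset.range n, x i) - g x) π :=
    ((integrable_finsetSum _ fun i _ => hi i).const_mul _).sub hg
  -- With c = 1/(n + 1), the error is c (1 - g) plus 1 - c times the error of the ordinary mean.
  have hsplit : (fun x : ℕ → ℝ => ((n : ℝ) + 1)⁻¹ * (1 + ∑ i ∈ Finset.range n, x i) - g x) =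
      (((n : ℝ) + 1)⁻¹ • fun x => 1 - g x) + ((1 - ((n : ℝ) + 1)⁻¹) •
        fun x : ℕ → ℝ => (n : ℝ)⁻¹ * (∑ i ∈ Finset.range n, x i) - g x) := by
    ext x
    simp only [Pi.add_apply, Pi.smul_apply, smul_eq_mul]
    field_simp
    ring
  rw [hsplit]
  refine (eLpNorm_add_le (((integrable_const 1).sub hg).smul _).aestronglyMeasurable
    (hmean.smul _).aestronglyMeasurable le_rfl).trans (add_le_add ?_ ?_)
  · rw [eLpNorm_const_smul, Real.enorm_of_nonneg (by positivity)]
    rfl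
  · rw [eLpNorm_const_smul]
    refine mul_le_of_le_one_left zero_le ?_
    have h0 : (0 : ℝ) < ((n : ℝ) + 1)⁻¹ := by positivity
    have h1 : ((n : ℝ) + 1)⁻¹ ≤ 1 := inv_le_one_of_one_le₀ (by simp)
    rw [Real.enorm_of_nonneg (by linarith)]
    exact ENNReal.ofReal_le_one.2 (by linarith)

end Exchangeable
end SwapInvariance

/-! ### Ratios under the measure with density `ξ 0` -/

namespace SwapInvariance

/-- The summand 1 is ξ_0/ξ_0, the term missing from the sequence of ratios. -/
theorem mean_succ_eq {Ω : Type*} {ξ : ℕ → Ω → ℝ} {ω : Ω} (hω : 0 < ξ 0 ω) (n : ℕ) :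
    ((n + 1 : ℕ) : ℝ)⁻¹ * ∑ i ∈ Finset.range (n + 1), ξ i ω =
      ξ 0 ω * (((n : ℝ) + 1)⁻¹ * (1 + ∑ i ∈ Finset.range n, ratioSeq ξ i ω)) := by
  have : ∑ i ∈ Finset.range n, ratioSeq ξ i ω = (∑ i ∈ Finset.range n, ξ (i + 1) ω) / ξ 0 ω := by
    rw [Finset.sum_div]; rfl
  rw [Finset.sum_range_succ', this]
  push_cast
  field_simp
  ring

section RatioLaw

variable {Ω : Type*} [m0 : MeasurableSpace Ω] {μ : Measure Ω} {ξ : ℕ → Ω → ℝ}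

/-- The law of the sequence of ratios under the measure with density `ξ 0`. -/
noncomputable def ratioLaw (μ : Measure Ω) (ξ : ℕ → Ω → ℝ) : Measure (ℕ → ℝ) :=
  (μ.withDensity fun ω => ENNReal.ofReal (ξ 0 ω)).map fun ω n => ratioSeq ξ n ω

theorem measurable_ratioSeq (hmeas : ∀ i, Measurable (ξ i)) (n : ℕ) :
    Measurable (ratioSeq ξ n) :=
  (hmeas (n + 1)).div (hmeas 0)

theorem measurable_ratioSeq_pi (hmeas : ∀ i, Measurable (ξ i)) :
    Measurable fun ω n => ratioSeq ξ n ω :=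
  measurable_pi_lambda _ (measurable_ratioSeq hmeas)

theorem isFiniteMeasure_ratioLaw (hint : Integrable (ξ 0) μ) : IsFiniteMeasure (ratioLaw μ ξ) := by
  have : IsFiniteMeasure (μ.withDensity fun ω => ENNReal.ofReal (ξ 0 ω)) :=
    isFiniteMeasure_withDensity_ofReal hint.2
  unfold ratioLaw
  infer_instance

/-- The density is positive almost everywhere, so null sets of the weighted measure are null for
`μ`. -/
theorem ae_comp_ratioSeq (hmeas : ∀ i, Measurable (ξ i)) (hpos : ∀ᵐ ω ∂μ, 0 < ξ 0 ω)
    {p : (ℕ → ℝ) → Prop} (h : ∀ᵐ x ∂ratioLaw μ ξ, p x) :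
    ∀ᵐ ω ∂μ, p fun n => ratioSeq ξ n ω := by
  have h1 := ae_of_ae_map (measurable_ratioSeq_pi hmeas).aemeasurable h
  rw [ae_withDensity_iff (hmeas 0).ennreal_ofReal] at h1
  filter_upwards [h1, hpos] with ω h2 h3
  exact h2 (by simpa using h3)

theorem eLpNorm_one_ratioLaw (hmeas : ∀ i, Measurable (ξ i)) (hpos : ∀ᵐ ω ∂μ, 0 < ξ 0 ω)
    {f : (ℕ → ℝ) → ℝ} (hf : Measurable f) :
    eLpNorm f 1 (ratioLaw μ ξ) = eLpNorm (fun ω => ξ 0 ω * f fun n => ratioSeq ξ n ω) 1 μ := by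
  rw [eLpNorm_one_eq_lintegral_enorm, eLpNorm_one_eq_lintegral_enorm, ratioLaw,
    lintegral_map hf.enorm (measurable_ratioSeq_pi hmeas),
    lintegral_withDensity_eq_lintegral_mul _ (hmeas 0).ennreal_ofReal
      (show Measurable fun ω => ‖f fun n => ratioSeq ξ n ω‖ₑ from
        hf.enorm.comp (measurable_ratioSeq_pi hmeas))]
  refine lintegral_congr_ae ?_
  filter_upwards [hpos] with ω hω
  simp [enorm_mul, Real.enorm_of_nonneg hω.le]

theorem integrable_ratioLaw_iff (hmeas : ∀ i, Measurable (ξ i)) (hpos : ∀ᵐ ω ∂μ, 0 < ξ 0 ω)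
    {f : (ℕ → ℝ) → ℝ} (hf : Measurable f) :
    Integrable f (ratioLaw μ ξ) ↔ Integrable (fun ω => ξ 0 ω * f fun n => ratioSeq ξ n ω) μ := by
  rw [← memLp_one_iff_integrable, ← memLp_one_iff_integrable, MemLp, MemLp,
    eLpNorm_one_ratioLaw hmeas hpos hf]
  exact and_congr_left fun _ => iff_of_true hf.aestronglyMeasurable
    ((hmeas 0).mul (hf.comp (measurable_ratioSeq_pi hmeas))).aestronglyMeasurable

theorem setIntegral_ratioLaw (hmeas : ∀ i, Measurable (ξ i)) (hpos : ∀ᵐ ω ∂μ, 0 < ξ 0 ω)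
    {f : (ℕ → ℝ) → ℝ} (hf : Measurable f) {s : Set (ℕ → ℝ)} (hs : MeasurableSet s) :
    ∫ x in s, f x ∂ratioLaw μ ξ =
      ∫ ω in (fun ω n => ratioSeq ξ n ω) ⁻¹' s, ξ 0 ω * f (fun n => ratioSeq ξ n ω) ∂μ := by
  have hm := measurable_ratioSeq_pi hmeas
  rw [ratioLaw, setIntegral_map hs hf.aestronglyMeasurable hm.aemeasurable,
    setIntegral_withDensity_eq_setIntegral_toReal_smul (hmeas 0).ennreal_ofReal
      (ae_of_all _ fun _ => ENNReal.ofReal_lt_top) _ (hm hs)]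
  refine setIntegral_congr_ae (hm hs) ?_
  filter_upwards [hpos] with ω hω _
  rw [ENNReal.toReal_ofReal hω.le, smul_eq_mul]

theorem integral_ratioLaw (hmeas : ∀ i, Measurable (ξ i)) (hpos : ∀ᵐ ω ∂μ, 0 < ξ 0 ω)
    {f : (ℕ → ℝ) → ℝ} (hf : Measurable f) :
    ∫ x, f x ∂ratioLaw μ ξ = ∫ ω, ξ 0 ω * f (fun n => ratioSeq ξ n ω) ∂μ := by
  simpa using setIntegral_ratioLaw hmeas hpos hf MeasurableSet.univ

theorem integrable_eval_ratioLaw (hmeas : ∀ i, Measurable (ξ i)) (hpos : ∀ᵐ ω ∂μ, 0 < ξ 0 ω)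
    (hint : ∀ i, Integrable (ξ i) μ) (i : ℕ) : Integrable (fun x => x i) (ratioLaw μ ξ) := by
  rw [integrable_ratioLaw_iff hmeas hpos (measurable_pi_apply i)]
  refine (hint (i + 1)).congr ?_
  filter_upwards [hpos] with ω hω
  simp only [ratioSeq]
  field_simp

/-- Swapping ratios 0 and i means swapping ξ_1 and ξ_{i+1}, while the common denominator ξ_0, with
coefficient -t, stays fixed. -/
theorem IsSwapInvariantSeq.integral_abs_sum_swap (hswap : IsSwapInvariantSeq μ ξ) {i M : ℕ}
    (hi : i < M) (v : ℕ → ℝ) (t : ℝ) :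
    ∫ ω, |∑ j ∈ Finset.range M, v j * ξ (Equiv.swap 0 i j + 1) ω - t * ξ 0 ω| ∂μ =
      ∫ ω, |∑ j ∈ Finset.range M, v j * ξ (j + 1) ω - t * ξ 0 ω| ∂μ := by
  have hM : 0 < M := by omega
  have h := (hswap.2 (M + 1) Fin.val Fin.val_strictMono).2
    (Equiv.swap (Fin.succ ⟨0, hM⟩) (Fin.succ ⟨i, hi⟩)) (Fin.cons (-t) fun j => v j)
  simp only [Fin.sum_univ_succ, Fin.cons_zero, Fin.cons_succ] at h
  have h0 : Equiv.swap (Fin.succ ⟨0, hM⟩) (Fin.succ ⟨i, hi⟩) 0 = 0 :=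
    Equiv.swap_apply_of_ne_of_ne (Fin.succ_ne_zero _).symm (Fin.succ_ne_zero _).symm
  have hs : ∀ j : Fin M, ((Equiv.swap (Fin.succ ⟨0, hM⟩) (Fin.succ ⟨i, hi⟩) j.succ : Fin (M + 1))
      : ℕ) = Equiv.swap 0 i (j : ℕ) + 1 := fun j => by
    rw [(Fin.succ_injective M).swap_apply, Fin.val_succ]
    congr 1
    exact (Fin.val_injective.swap_apply (⟨0, hM⟩ : Fin M) ⟨i, hi⟩ j).symm
  simp only [h0, hs, Fin.val_zero, Fin.val_succ] at h
  have e1 : ∀ ω, ∑ j : Fin M, v j * ξ (Equiv.swap 0 i (j : ℕ) + 1) ω =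
      ∑ j ∈ Finset.range M, v j * ξ (Equiv.swap 0 i j + 1) ω := fun ω =>
    Fin.sum_univ_eq_sum_range (fun j => v j * ξ (Equiv.swap 0 i j + 1) ω) M
  have e2 : ∀ ω, ∑ j : Fin M, v j * ξ ((j : ℕ) + 1) ω =
      ∑ j ∈ Finset.range M, v j * ξ (j + 1) ω := fun ω =>
    Fin.sum_univ_eq_sum_range (fun j => v j * ξ (j + 1) ω) M
  simp only [e1, e2] at h
  simpa only [neg_mul, neg_add_eq_sub] using h

/-- The ratios of a swap-invariant sequence are exchangeable under the measure with density
`ξ 0`. -/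
theorem IsSwapInvariantSeq.map_swap_ratioLaw (hswap : IsSwapInvariantSeq μ ξ)
    (hmeas : ∀ i, Measurable (ξ i)) (hpos : ∀ᵐ ω ∂μ, 0 < ξ 0 ω) (i : ℕ) :
    (ratioLaw μ ξ).map (fun x => x ∘ Equiv.swap 0 i) = ratioLaw μ ξ := by
  have hfin := isFiniteMeasure_ratioLaw (hswap.1 0)
  have hm : Measurable fun x : ℕ → ℝ => x ∘ Equiv.swap 0 i :=
    measurable_pi_lambda _ fun j => measurable_pi_apply _
  have hev := integrable_eval_ratioLaw hmeas hpos hswap.1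
  refine ext_of_integral_abs_sum_sub (fun j => ?_) hev ?_ fun N v t => ?_
  · rw [integrable_map_measure (measurable_pi_apply j).aestronglyMeasurable hm.aemeasurable]
    exact hev _
  · rw [Measure.map_apply hm MeasurableSet.univ, Set.preimage_univ]
  · have hf : Measurable fun x : ℕ → ℝ => |∑ j ∈ Finset.range N, v j * x j - t| := by fun_prop
    rw [integral_map hm.aemeasurable hf.aestronglyMeasurable,
      integral_ratioLaw hmeas hpos (show Measurable fun x : ℕ → ℝ =>
        |∑ j ∈ Finset.range N, v j * (x ∘ Equiv.swap 0 i) j - t| from hf.comp hm),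
      integral_ratioLaw hmeas hpos hf]
    -- Padding `v` with zeros makes the range long enough to contain the swapped index i.
    let w : ℕ → ℝ := fun j => if j < N then v j else 0
    have hw : ∀ y : ℕ → ℝ, ∑ j ∈ Finset.range (N + i + 1), w j * y j =
        ∑ j ∈ Finset.range N, v j * y j := fun y => by
      rw [← Finset.sum_subset (Finset.range_subset_range.2 (by omega : N ≤ N + i + 1))
        (fun j _ hj => by simp_all [w])]
      exact Finset.sum_congr rfl fun j hj => by simp_all [w]
    have h := hswap.integral_abs_sum_swap (by omega : i < N + i + 1) w t
    have key : ∀ (τ : ℕ → ℕ) (ω : Ω), 0 < ξ 0 ω →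
        |∑ j ∈ Finset.range (N + i + 1), w j * ξ (τ j + 1) ω - t * ξ 0 ω| =
          ξ 0 ω * |∑ j ∈ Finset.range N, v j * ratioSeq ξ (τ j) ω - t| := fun τ ω hω => by
      rw [hw fun j => ξ (τ j + 1) ω]
      nth_rewrite 2 [← abs_of_pos hω]
      rw [← abs_mul, mul_sub, Finset.mul_sum, mul_comm t]
      congr 2
      refine Finset.sum_congr rfl fun j _ => ?_
      simp only [ratioSeq]
      field_simp
    rw [integral_congr_ae (hpos.mono fun ω hω => key (Equiv.swap 0 i) ω hω)] at h
    exact h.trans (integral_congr_ae (hpos.mono fun ω hω => key id ω hω))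

/-- The conditional expectation of a positive random variable is positive. -/
theorem condExp_pos_ae [IsFiniteMeasure μ] {m : MeasurableSpace Ω} (hm : m ≤ m0) {f : Ω → ℝ}
    (hf : Integrable f μ) (hpos : ∀ᵐ ω ∂μ, 0 < f ω) : ∀ᵐ ω ∂μ, 0 < (μ[f | m]) ω := by
  -- On this set f has integral at most 0 although it is positive, so the set is null.
  have hB : MeasurableSet[m] {ω | (μ[f | m]) ω ≤ 0} :=
    @measurableSet_le _ _ _ _ _ m _ _ _ _ _ stronglyMeasurable_condExp.measurable
      measurable_const
  have hle : ∫ ω in {ω | (μ[f | m]) ω ≤ 0}, f ω ∂μ ≤ 0 := by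
    rw [← setIntegral_condExp hm hf hB]
    exact setIntegral_nonpos (hm _ hB) fun ω hω => hω
  have hnn : 0 ≤ᵐ[μ.restrict {ω | (μ[f | m]) ω ≤ 0}] f :=
    ae_restrict_of_ae (hpos.mono fun ω hω => hω.le)
  have hzero := (setIntegral_eq_zero_iff_of_nonneg_ae hnn hf.integrableOn).1
    (le_antisymm hle (integral_nonneg_of_ae hnn))
  rw [Filter.EventuallyEq, ae_restrict_iff' (hm _ hB)] at hzero
  filter_upwards [hzero, hpos] with ω h1 h2
  by_contra hc
  exact h2.ne' (h1 (not_lt.1 hc))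

/-- Bayes' formula for the conditional expectation under the measure with density `ξ 0`. -/
theorem condExp_one_ae_eq [IsFiniteMeasure μ] (hmeas : ∀ i, Measurable (ξ i))
    (hpos : ∀ᵐ ω ∂μ, 0 < ξ 0 ω) (hint : ∀ i, Integrable (ξ i) μ) :
    μ[ξ 1 | permInvariantSigma (ratioSeq ξ)] =ᵐ[μ]
      fun ω => ((ratioLaw μ ξ)[fun x => x 0 | permInvariantSets]) (fun n => ratioSeq ξ n ω) *
        (μ[ξ 0 | permInvariantSigma (ratioSeq ξ)]) ω := by
  have hfin := isFiniteMeasure_ratioLaw (hint 0)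
  set g := (ratioLaw μ ξ)[fun x => x 0 | permInvariantSets] with hg
  have hgs : StronglyMeasurable[permInvariantSets] g := stronglyMeasurable_condExp
  have hgm : Measurable g := (hgs.mono permInvariantSets_le).measurable
  have hE := permInvariantSigma_le (measurable_ratioSeq hmeas)
  have hY : StronglyMeasurable[permInvariantSigma (ratioSeq ξ)]
      (fun ω => g fun n => ratioSeq ξ n ω) :=
    hgs.comp_measurable (comap_measurable _)
  have hYint : Integrable ((fun ω => g fun n => ratioSeq ξ n ω) * ξ 0) μ := by
    have := (integrable_ratioLaw_iff hmeas hpos hgm).1 integrable_condExp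
    rw [mul_comm]
    exact this
  -- Pulling out the 𝓔-measurable factor g(r) leaves E(g(r) ξ_0 | 𝓔) = E(ξ_1 | 𝓔), tested below on
  -- events {r ∈ B}. There it is the defining property of g under `ratioLaw`, since ξ_0 r_0 = ξ_1.
  refine EventuallyEq.trans (EventuallyEq.symm ?_)
    (condExp_mul_of_stronglyMeasurable_left hY hYint (hint 0))
  refine ae_eq_condExp_of_forall_setIntegral_eq hE (hint 1)
    (fun s _ _ => integrable_condExp.integrableOn) ?_
    stronglyMeasurable_condExp.aestronglyMeasurable
  rintro s hs -
  rw [setIntegral_condExp hE hYint hs]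
  obtain ⟨B, hB, rfl⟩ := hs
  have h1 := setIntegral_condExp permInvariantSets_le
    (integrable_eval_ratioLaw hmeas hpos hint 0) hB
  rw [setIntegral_ratioLaw hmeas hpos hgm hB.1,
    setIntegral_ratioLaw hmeas hpos (measurable_pi_apply 0) hB.1] at h1
  have hBm := measurable_ratioSeq_pi hmeas hB.1
  refine Eq.trans ?_ (h1.trans ?_)
  · exact setIntegral_congr_fun hBm fun ω _ => mul_comm _ _
  · refine setIntegral_congr_ae hBm ?_
    filter_upwards [hpos] with ω hω _
    simp only [ratioSeq]
    field_simp

theorem ergodicLimit_ae_eq [IsFiniteMeasure μ] (hmeas : ∀ i, Measurable (ξ i))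
    (hpos : ∀ᵐ ω ∂μ, 0 < ξ 0 ω) (hint : ∀ i, Integrable (ξ i) μ) :
    ergodicLimit μ ξ =ᵐ[μ] fun ω => ξ 0 ω *
      ((ratioLaw μ ξ)[fun x => x 0 | permInvariantSets]) (fun n => ratioSeq ξ n ω) := by
  filter_upwards [condExp_one_ae_eq hmeas hpos hint,
    condExp_pos_ae (permInvariantSigma_le (measurable_ratioSeq hmeas)) (hint 0) hpos] with ω h1 h2
  rw [ergodicLimit, h1]
  field_simp

end RatioLaw
end SwapInvariance

open SwapInvariance in
theorem mainTheorem7 {Ω : Type*} [MeasurableSpace Ω] (μ : Measure Ω) [IsProbabilityMeasure μ]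
    (ξ : ℕ → Ω → ℝ) (hmeas : ∀ i, Measurable (ξ i))
    (hpos : ∀ i, ∀ᵐ ω ∂μ, 0 < ξ i ω)
    (hswap : SwapInvariance.IsSwapInvariantSeq μ ξ) :
    (∀ᵐ ω ∂μ, 0 < (μ[ξ 0 | SwapInvariance.permInvariantSigma (SwapInvariance.ratioSeq ξ)]) ω) ∧
    Integrable (SwapInvariance.ergodicLimit μ ξ) μ ∧
    (∀ᵐ ω ∂μ, Tendsto (fun n : ℕ => (n : ℝ)⁻¹ * ∑ i ∈ Finset.range n, ξ i ω) atTop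
      (𝓝 (SwapInvariance.ergodicLimit μ ξ ω))) ∧
    Tendsto (fun n : ℕ => eLpNorm
      (fun ω => (n : ℝ)⁻¹ * (∑ i ∈ Finset.range n, ξ i ω) - SwapInvariance.ergodicLimit μ ξ ω) 1 μ)
      atTop (𝓝 0) := by
  have hfin := isFiniteMeasure_ratioLaw (hswap.1 0)
  have hX := ergodicLimit_ae_eq hmeas (hpos 0) hswap.1
  have hx0 := integrable_eval_ratioLaw hmeas (hpos 0) hswap.1 0
  have hex := hswap.map_swap_ratioLaw hmeas (hpos 0)
  set g := (ratioLaw μ ξ)[fun x => x 0 | permInvariantSets] with hg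
  have hgm : Measurable g :=
    ((stronglyMeasurable_condExp (m := permInvariantSets)).mono permInvariantSets_le).measurable
  refine ⟨condExp_pos_ae (permInvariantSigma_le (measurable_ratioSeq hmeas)) (hswap.1 0) (hpos 0),
    ?_, ?_, ?_⟩
  · exact ((integrable_ratioLaw_iff hmeas (hpos 0) hgm).1 integrable_condExp).congr hX.symm
  · filter_upwards [hX, hpos 0, ae_comp_ratioSeq hmeas (hpos 0)
      (tendsto_ae_shifted_mean_of_exchangeable hx0 hex)] with ω h1 h2 h3
    -- The shift by one matches a mean of n + 1 terms of ξ with n ratios.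
    rw [← tendsto_add_atTop_iff_nat 1, h1]
    exact (h3.const_mul (ξ 0 ω)).congr fun n => (mean_succ_eq h2 n).symm
  · rw [← tendsto_add_atTop_iff_nat 1]
    refine (tendsto_eLpNorm_shifted_mean_of_exchangeable hx0 hex).congr fun n => ?_
    rw [eLpNorm_one_ratioLaw hmeas (hpos 0) (show Measurable fun x : ℕ → ℝ =>
      ((n : ℝ) + 1)⁻¹ * (1 + ∑ i ∈ Finset.range n, x i) - g x by fun_prop)]
    refine eLpNorm_congr_ae ?_
    filter_upwards [hX, hpos 0] with ω h1 h2
    rw [mean_succ_eq h2, h1, mul_sub]
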